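/- Let $n\ge 1$ and let $\mathbf f=(f_1,\dots,f_n)$ be a triangular system, i.e. $f_i\in\mathbb C[z_1,\dots,z_i]$ for $1\le i\le n$. For a system $\mathbf g$ of $k$ polynomials in $k$ complex variables and a set $S\subseteq\mathbb C^k$, let $\#(S,\mathbf g)\in\mathbb N\cup\{\infty\}$ denote the sum, over all solutions $\mathbf a\in S$ of $\mathbf g=\mathbf 0$, of the intersection multiplicity of $\mathbf a$ in $\mathbf g$, that is, of $\dim_{\mathbb C}\mathcal O_{\mathbf a}/(\mathbf g)\mathcal O_{\mathbf a}$, where $\mathcal O_{\mathbf a}$ is the localization of $\mathbb C[z_1,\dots,z_k]$ at the maximal ideal of $\mathbf a$. Let $\boldsymbol\Delta=(\Delta_1,\dots,\Delta_n)$ be a polydisc (a vector of complex discs of positive radius, open or closed, identified with the set $\prod_i\Delta_i\subseteq\mathbb C^n$), and let $\mathbf m=(m_1,\dots,m_n)$ be a vector of positive integers. The pair $(\boldsymbol\Delta,\mathbf m)$ is called a *tower* of height $n$ relative to $\mathbf f$ if: when $n=1$, $m_1=\#(\Delta_1,f_1)$; when $n>1$, (i) $((\Delta_1,\dots,\Delta_{n-1}),(m_1,\dots,m_{n-1}))$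 is a tower relative to $(f_1,\dots,f_{n-1})$, and (ii) for every $\mathbf b\in\Delta_1\times\dots\times\Delta_{n-1}$, $m_n=\#(\Delta_n,f_n(\mathbf b,\cdot))$, where $f_n(\mathbf b,\cdot)=f_n(b_1,\dots,b_{n-1},z_n)$ is regarded as a polynomial in the one variable $z_n$. It is called a *natural tower* if the analogous conditions hold in which, in addition, $m_1=\#(3\Delta_1,f_1)$ in the case $n=1$ and $m_n=\#(3\Delta_n,f_n(\mathbf b,\cdot))$ in (ii), where $3\Delta_i$ is the disc with the same centre as $\Delta_i$ and three times its radius; every natural tower is a tower. Let $(\boldsymbol\Delta,\mathbf m)$ be a tower (for instance, a natural tower) of height $n$ relative to $\mathbf f$. If $n>1$, then $$\#(\boldsymbol\Delta,\mathbf f)=m_n\cdot\#\bigl((\Delta_1,\dots,\Delta_{n-1}),(f_1,\dots,f_{n-1})\bigr).$$ Inductively, for every $n\ge1$, $$\#(\boldsymbol\Delta,\mathbf f)=\prod_{i=1}^n m_i .$$ -/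

import Mathlib

noncomputable section

namespace ClusterTower

open MvPolynomial

/-! ### Discs and polydiscs -/

/-- A complex disc, given by its centre and its positive radius.  Both open and closed discs are
allowed; `closed` records whether the bounding circle belongs to the disc. -/
structure Disc where
  center : ℂ
  radius : ℝ
  radius_pos : 0 < radius
  closed : Bool

/-- The set of points of a disc. -/
def Disc.toSet (D : Disc) : Set ℂ :=
  if D.closed then Metric.closedBall D.center D.radius else Metric.ball D.center D.radius

/-- The disc `3 D`, with the same centre as `D` and three times its radius. -/
def Disc.triple (D : Disc) : Disc where
  center := D.center
  radius := 3 * D.radius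
  radius_pos := mul_pos (by norm_num) D.radius_pos
  closed := D.closed

/-- A polydisc in `ℂⁿ` is a vector of `n` complex discs. -/
abbrev Polydisc (n : ℕ) := Fin n → Disc

/-- A polydisc as a subset of `ℂⁿ`: the product of its components. -/
def Polydisc.toSet {n : ℕ} (Δ : Polydisc n) : Set (Fin n → ℂ) :=
  {z | ∀ i, z i ∈ (Δ i).toSet}

/-- The polydisc `3 Δ`. -/
def Polydisc.triple {n : ℕ} (Δ : Polydisc n) : Polydisc n := fun i => (Δ i).triple

/-! ### Polynomial systems, multiplicities, total multiplicities -/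

/-- A system of `n` polynomial equations in `n` complex variables. -/
abbrev PolySystem (n : ℕ) := Fin n → MvPolynomial (Fin n) ℂ

/-- The set of solutions in `ℂⁿ` of a polynomial system. -/
def solutionSet {n : ℕ} (F : PolySystem n) : Set (Fin n → ℂ) :=
  {a | ∀ i, eval a (F i) = 0}

/-- The maximal ideal of `ℂ[z₁, …, zₙ]` consisting of the polynomials that vanish at `a`. -/
def pointIdeal {n : ℕ} (a : Fin n → ℂ) : Ideal (MvPolynomial (Fin n) ℂ) :=
  RingHom.ker (eval a)

instance pointIdeal_isPrime {n : ℕ} (a : Fin n → ℂ) : (pointIdeal a).IsPrime :=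
  RingHom.ker_isPrime (eval a)

/-- The local ring of the system `F` at the point `a`: the localization of `ℂ[z₁, …, zₙ]` at the
maximal ideal of `a`, modulo the ideal generated by the polynomials of `F`. -/
abbrev LocalRingAt {n : ℕ} (F : PolySystem n) (a : Fin n → ℂ) : Type :=
  Localization.AtPrime (pointIdeal a) ⧸
    (Ideal.span (Set.range F)).map
      (algebraMap (MvPolynomial (Fin n) ℂ) (Localization.AtPrime (pointIdeal a)))

/-- The intersection multiplicity of `a` in `F`: the dimension over `ℂ` of the local ring of `F`
at `a` (equal to `⊤` if this dimension is infinite). -/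
def multiplicityAt {n : ℕ} (a : Fin n → ℂ) (F : PolySystem n) : ℕ∞ :=
  Cardinal.toENat (Module.rank ℂ (LocalRingAt F a))

/-- `#(S, F)`: the total multiplicity of the multiset of solutions of `F` in `S`.  It is a sum in
`ℕ∞`, hence the supremum of all finite partial sums. -/
def totalMultiplicity {n : ℕ} (S : Set (Fin n → ℂ)) (F : PolySystem n) : ℕ∞ :=
  ∑' a : ↥(S ∩ solutionSet F), multiplicityAt (a : Fin n → ℂ) F

/-! ### Triangular systems -/

/-- A triangular system `f = (f₁, …, fₙ)`, with `fᵢ ∈ ℂ[z₁, …, zᵢ]`.  Indices start at `0` here,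
so that the polynomial of index `i` has the `i + 1` variables of indices `0, …, i`. -/
abbrev TriangularSystem (n : ℕ) := (i : Fin n) → MvPolynomial (Fin (i + 1)) ℂ

/-- A triangular system as a system of `n` polynomials in all the variables `z₁, …, zₙ`. -/
def TriangularSystem.toPolySystem {n : ℕ} (f : TriangularSystem n) : PolySystem n :=
  fun i => rename (Fin.castLE (Nat.succ_le_of_lt i.isLt)) (f i)

/-- The triangular system `(f₁, …, fₙ)` obtained from `(f₁, …, fₙ₊₁)`. -/
def TriangularSystem.init {n : ℕ} (f : TriangularSystem (n + 1)) : TriangularSystem n :=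
  fun i => f i.castSucc

/-- The last polynomial `fₙ₊₁ ∈ ℂ[z₁, …, zₙ₊₁]` of a triangular system. -/
def TriangularSystem.last {n : ℕ} (f : TriangularSystem (n + 1)) : MvPolynomial (Fin (n + 1)) ℂ :=
  f (Fin.last n)

/-- The specialization `g(b) = g(b₁, …, bₙ, z)` of `g ∈ ℂ[z₁, …, zₙ₊₁]` at `b ∈ ℂⁿ`, a polynomial
in one variable, regarded as a system of one equation. -/
def specialize {n : ℕ} (g : MvPolynomial (Fin (n + 1)) ℂ) (b : Fin n → ℂ) : PolySystem 1 :=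
  fun _ => bind₁ (Fin.snoc (α := fun _ => MvPolynomial (Fin 1) ℂ) (fun j => C (b j)) (X 0)) g

/-! ### Cluster representations and towers -/

/-- `(Δ, m)` is a cluster representation relative to `F`: `m = #(Δ, F)`. -/
def IsClusterRep {n : ℕ} (Δ : Polydisc n) (m : ℕ+) (F : PolySystem n) : Prop :=
  ((m : ℕ) : ℕ∞) = totalMultiplicity Δ.toSet F

/-- `(Δ, m)` is a natural cluster representation relative to `F`: both `(Δ, m)` and `(3Δ, m)` are
cluster representations. -/
def IsNaturalClusterRep {n : ℕ} (Δ : Polydisc n) (m : ℕ+) (F : PolySystem n) : Prop :=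
  IsClusterRep Δ m F ∧ IsClusterRep Δ.triple m F

/-- `(Δ, m)` is a tower of height `n + 1` relative to the triangular system `f`. -/
def IsTower : {n : ℕ} → TriangularSystem (n + 1) → Polydisc (n + 1) → (Fin (n + 1) → ℕ+) → Prop
  | 0, f, Δ, m => IsClusterRep Δ (m 0) f.toPolySystem
  | n + 1, f, Δ, m =>
      IsTower f.init (Fin.init Δ) (Fin.init m) ∧
        ∀ b ∈ Polydisc.toSet (Fin.init Δ : Polydisc (n + 1)),
          IsClusterRep (fun _ : Fin 1 => Δ (Fin.last (n + 1))) (m (Fin.last (n + 1)))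
            (specialize f.last b)

/-- `(Δ, m)` is a natural tower of height `n + 1` relative to the triangular system `f`: the
definition of a tower with `cluster` replaced by `natural cluster`. -/
def IsNaturalTower :
    {n : ℕ} → TriangularSystem (n + 1) → Polydisc (n + 1) → (Fin (n + 1) → ℕ+) → Prop
  | 0, f, Δ, m => IsNaturalClusterRep Δ (m 0) f.toPolySystem
  | n + 1, f, Δ, m =>
      IsNaturalTower f.init (Fin.init Δ) (Fin.init m) ∧
        ∀ b ∈ Polydisc.toSet (Fin.init Δ : Polydisc (n + 1)),
          IsNaturalClusterRep (fun _ : Fin 1 => Δ (Fin.last (n + 1))) (m (Fin.last (n + 1)))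
            (specialize f.last b)

/-- Every natural tower is a tower. -/
theorem IsNaturalTower.isTower : {n : ℕ} → {f : TriangularSystem (n + 1)} →
    {Δ : Polydisc (n + 1)} → {m : Fin (n + 1) → ℕ+} → IsNaturalTower f Δ m → IsTower f Δ m
  | 0, _, _, _, h => h.1
  | _ + 1, _, _, _, h => ⟨IsNaturalTower.isTower h.1, fun b hb => (h.2 b hb).1⟩

end ClusterTower

end

noncomputable section

namespace ClusterTower

open MvPolynomial

/-! ### The Weierstrass factorization of a polynomial over an Artinian local ring -/

/-! Multiplicity is multiplicative along the projection that forgets the last coordinate. Let `A` be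
the local ring of the first `n` equations at a solution `b`. If it has finite dimension over `ℂ`, it
is an Artinian local ring with residue field `ℂ`. The last equation, with `X + c` for the last
variable, becomes a polynomial over `A` whose reduction is its specialization at `b`, of some order
`k` at `0`. By Weierstrass factorization it equals `G * H`, with `G` monic of degree `k` reducing to
`X ^ k` and `H` a unit near the point. The local ring at `(b, c)` is then `A[X]/(G)`, free of rank
`k` over `A` (`multiplicityAt_snoc`).

The case of no earlier equations shows that `k` is the multiplicity of `c` in the specialization.
Summing over the fibre of `b` gives `m` times the multiplicity of `b`, and summing over `b` gives
the recursion (`totalMultiplicity_succ`). Induction on the height yields the product, and with it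
the finiteness that makes each `A` Artinian. -/

theorem isAdicComplete_of_isNilpotent {A : Type*} [CommRing A] {I : Ideal A}
    (hI : IsNilpotent I) : IsAdicComplete I A := by
  obtain ⟨N, hN⟩ := hI
  have hbot : I ^ N • (⊤ : Submodule A A) = ⊥ := by rw [hN]; simp
  refine { haus' := fun x hx => ?_, prec' := fun f hf => ⟨f N, fun n => ?_⟩ }
  · have := hx N
    rwa [hbot, SModEq.bot] at this
  · rcases le_total n N with h | h
    · exact hf h
    · have := hf h
      rw [hbot, SModEq.bot] at this
      rw [this]

/-- A polynomial over a local ring with nilpotent maximal ideal, whose reduction has order `k`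
at `0`, is the product of a monic polynomial of degree `k` reducing to `X ^ k` and of a polynomial
with invertible constant coefficient. -/
theorem exists_monic_mul_eq {A : Type*} [CommRing A] [IsLocalRing A]
    (hnil : IsNilpotent (IsLocalRing.maximalIdeal A)) (g : Polynomial A) (k : ℕ)
    (hk : g.coeff k ∉ IsLocalRing.maximalIdeal A)
    (hlt : ∀ i < k, g.coeff i ∈ IsLocalRing.maximalIdeal A) :
    ∃ G H : Polynomial A, G.Monic ∧ G.natDegree = k ∧
      (∀ i < k, G.coeff i ∈ IsLocalRing.maximalIdeal A) ∧ g = G * H ∧ IsUnit (H.coeff 0) := by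
  have := isAdicComplete_of_isNilpotent hnil
  have hord : ((g : PowerSeries A).map (IsLocalRing.residue A)).order = k := by
    rw [PowerSeries.order_eq_nat]
    simpa [IsLocalRing.residue_eq_zero_iff] using And.intro hk hlt
  have hne : (g : PowerSeries A).map (IsLocalRing.residue A) ≠ 0 := by
    intro h
    rw [h, PowerSeries.order_zero] at hord
    exact ENat.top_ne_natCast k hord
  obtain ⟨G, h, hG⟩ := PowerSeries.exists_isWeierstrassFactorization hne
  have hdeg : G.natDegree = k := by rw [hG.natDegree_eq_toNat_order_map, hord]; rfl
  have hmon : G.Monic := hG.isDistinguishedAt.monic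
  have hordG : ((G : PowerSeries A).map
      (Ideal.Quotient.mk (IsLocalRing.maximalIdeal A))).order = k := by
    rw [PowerSeries.order_eq_nat]
    constructor
    · have : G.coeff k = 1 := by rw [← hdeg]; exact hmon
      simp [this]
    · intro i hi
      simpa [Ideal.Quotient.eq_zero_iff_mem] using
        hG.isDistinguishedAt.mem (hdeg.symm ▸ hi)
  -- Euclidean division by the monic `G` and the factorization `G * h` are two Weierstrass divisions
  -- of `g` by `G`. Uniqueness kills the remainder and shows that the cofactor `h` is a polynomial.
  have hdiv : (G : PowerSeries A) * ((g /ₘ G : Polynomial A) : PowerSeries A) +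
      ((g %ₘ G : Polynomial A) : PowerSeries A) = G * h + ((0 : Polynomial A) : PowerSeries A) := by
    rw [Polynomial.coe_zero, add_zero, ← hG.eq_mul, ← Polynomial.coe_mul, ← Polynomial.coe_add,
      add_comm, Polynomial.modByMonic_add_div]
  obtain ⟨hq, hr⟩ := hG.isDistinguishedAt.isWeierstrassDivisorAt'.eq_of_mul_add_eq_mul_add
    (by rw [hordG, ENat.toNat_natCast, ← hdeg, ← Polynomial.degree_eq_natDegree hmon.ne_zero]
        exact Polynomial.degree_modByMonic_lt _ hmon)
    (by rw [Polynomial.degree_zero]; exact WithBot.bot_lt_coe _) hdiv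
  refine ⟨G, g /ₘ G, hmon, hdeg, fun i hi => hG.isDistinguishedAt.mem (hdeg.symm ▸ hi), ?_, ?_⟩
  · have := Polynomial.modByMonic_add_div g G
    rwa [hr, zero_add, eq_comm] at this
  · have h0 := PowerSeries.isUnit_constantCoeff h hG.isUnit
    rw [← hq] at h0
    simpa using h0

/-! ### The local ring of a system at a point -/

/-- The local ring of the system `F` at the point `a`, as a type with one fixed ring structure. -/
def SolutionRing {n : ℕ} (F : PolySystem n) (a : Fin n → ℂ) : Type := LocalRingAt F a

instance {n : ℕ} (F : PolySystem n) (a : Fin n → ℂ) : CommRing (SolutionRing F a) :=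
  inferInstanceAs (CommRing (LocalRingAt F a))

instance {n : ℕ} (F : PolySystem n) (a : Fin n → ℂ) : Algebra ℂ (SolutionRing F a) :=
  inferInstanceAs (Algebra ℂ (LocalRingAt F a))

theorem multiplicityAt_eq {n : ℕ} (F : PolySystem n) (a : Fin n → ℂ) :
    multiplicityAt a F = Cardinal.toENat (Module.rank ℂ (SolutionRing F a)) :=
  rfl

section SolutionRing

variable {n : ℕ} (F : PolySystem n) (a : Fin n → ℂ)

/-- The germ of a polynomial at `a`, modulo the system. -/
def germ : MvPolynomial (Fin n) ℂ →ₐ[ℂ] SolutionRing F a :=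
  (Ideal.Quotient.mkₐ ℂ _).comp
    (Algebra.algHom ℂ (MvPolynomial (Fin n) ℂ) (Localization.AtPrime (pointIdeal a)))

theorem isUnit_germ {p : MvPolynomial (Fin n) ℂ} (hp : eval a p ≠ 0) : IsUnit (germ F a p) :=
  (IsLocalization.map_units (Localization.AtPrime (pointIdeal a))
    (⟨p, hp⟩ : (pointIdeal a).primeCompl)).map
      (Ideal.Quotient.mkₐ ℂ ((Ideal.span (Set.range F)).map
        (algebraMap _ (Localization.AtPrime (pointIdeal a)))))

theorem germ_apply_eq_zero (i : Fin n) : germ F a (F i) = 0 :=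
  Ideal.Quotient.eq_zero_iff_mem.2
    (Ideal.mem_map_of_mem _ (Ideal.subset_span (Set.mem_range_self i)))

variable {F a}

theorem SolutionRing.algHom_ext {B : Type*} [CommRing B] [Algebra ℂ B]
    {φ ψ : SolutionRing F a →ₐ[ℂ] B}
    (h : ∀ i, φ (germ F a (X i)) = ψ (germ F a (X i))) : φ = ψ :=
  Ideal.Quotient.algHom_ext ℂ <| IsLocalization.algHom_ext (pointIdeal a).primeCompl <|
    MvPolynomial.algHom_ext h

/-- The universal properties of localization and quotient combined. -/
theorem exists_lift {B : Type*} [CommRing B] [Algebra ℂ B] (φ : MvPolynomial (Fin n) ℂ →ₐ[ℂ] B)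
    (hu : ∀ p, eval a p ≠ 0 → IsUnit (φ p)) (h0 : ∀ i, φ (F i) = 0) :
    ∃ ψ : SolutionRing F a →ₐ[ℂ] B, ∀ p, ψ (germ F a p) = φ p := by
  let χ : Localization.AtPrime (pointIdeal a) →ₐ[ℂ] B :=
    IsLocalization.liftAlgHom (M := (pointIdeal a).primeCompl) (f := φ) fun y => hu _ y.2
  have hχ : ∀ p, χ (algebraMap _ _ p) = φ p := fun p => IsLocalization.lift_eq _ p
  refine ⟨Ideal.Quotient.liftₐ _ χ fun x hx => ?_, hχ⟩
  have hle : (Ideal.span (Set.range F)).map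
      (algebraMap _ (Localization.AtPrime (pointIdeal a))) ≤ RingHom.ker χ := by
    rw [Ideal.map_le_iff_le_comap, Ideal.span_le]
    rintro _ ⟨i, rfl⟩
    exact (hχ _).trans (h0 i)
  exact hle hx

/-- Evaluation at a solution, on the local ring at this solution. -/
theorem exists_evaluation (ha : a ∈ solutionSet F) :
    ∃ ε : SolutionRing F a →ₐ[ℂ] ℂ, ∀ p, ε (germ F a p) = eval a p := by
  obtain ⟨ε, h⟩ := exists_lift (F := F) (a := a) (aeval a : MvPolynomial (Fin n) ℂ →ₐ[ℂ] ℂ)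
    (fun p hp => by rw [isUnit_iff_ne_zero]; simpa [aeval_eq_eval] using hp)
    (fun i => by simpa [aeval_eq_eval] using ha i)
  exact ⟨ε, fun p => by rw [h, aeval_eq_eval]⟩

theorem nontrivial_solutionRing (ha : a ∈ solutionSet F) : Nontrivial (SolutionRing F a) :=
  (exists_evaluation ha).choose.toRingHom.domain_nontrivial

theorem isLocalRing_solutionRing (ha : a ∈ solutionSet F) : IsLocalRing (SolutionRing F a) :=
  have := nontrivial_solutionRing ha
  .of_surjective' (Ideal.Quotient.mk _) Ideal.Quotient.mk_surjective

/-- The kernel of `ε` is maximal because `ε` is onto `ℂ`, and a local ring has only one maximal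
ideal. -/
theorem mem_maximalIdeal_iff [IsLocalRing (SolutionRing F a)] (ε : SolutionRing F a →ₐ[ℂ] ℂ)
    (x : SolutionRing F a) : x ∈ IsLocalRing.maximalIdeal (SolutionRing F a) ↔ ε x = 0 := by
  have hs : Function.Surjective (ε : SolutionRing F a →+* ℂ) := fun z =>
    ⟨algebraMap ℂ _ z, ε.commutes z⟩
  rw [← IsLocalRing.eq_maximalIdeal (RingHom.ker_isMaximal_of_surjective _ hs)]
  rfl

theorem isUnit_iff_evaluation_ne_zero [IsLocalRing (SolutionRing F a)]
    (ε : SolutionRing F a →ₐ[ℂ] ℂ) (x : SolutionRing F a) : IsUnit x ↔ ε x ≠ 0 := by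
  rw [← IsLocalRing.notMem_maximalIdeal, mem_maximalIdeal_iff ε]

theorem multiplicityAt_ne_zero (ha : a ∈ solutionSet F) : multiplicityAt a F ≠ 0 := by
  have := nontrivial_solutionRing ha
  rw [multiplicityAt_eq, Ne, Cardinal.toENat_eq_zero]
  exact rank_pos.ne'

theorem isNilpotent_maximalIdeal [IsLocalRing (SolutionRing F a)] (h : multiplicityAt a F ≠ ⊤) :
    IsNilpotent (IsLocalRing.maximalIdeal (SolutionRing F a)) := by
  have : Module.Finite ℂ (SolutionRing F a) :=
    Module.rank_lt_aleph0_iff.1 (Cardinal.toENat_ne_top.1 h)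
  have : IsArtinianRing (SolutionRing F a) := IsArtinianRing.of_finite ℂ _
  rw [← IsLocalRing.jacobson_eq_maximalIdeal ⊥ bot_ne_top]
  exact IsArtinianRing.isNilpotent_jacobson_bot

end SolutionRing

theorem multiplicityAt_of_isEmpty (F : PolySystem 0) (a : Fin 0 → ℂ) : multiplicityAt a F = 1 := by
  obtain ⟨ε, -⟩ := exists_evaluation (F := F) (a := a) fun i => i.elim0
  have e : SolutionRing F a ≃ₐ[ℂ] ℂ := .ofAlgHom ε (Algebra.ofId _ _)
    (AlgHom.ext fun z => ε.commutes z) (SolutionRing.algHom_ext fun i => i.elim0)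
  rw [multiplicityAt_eq, e.toLinearEquiv.rank_eq, Module.rank_self, Cardinal.toENat_eq_one]

/-! ### Polynomials in the last variable -/

section Fiber

variable {n : ℕ} {A B : Type*} [CommRing A] [Algebra ℂ A] [CommRing B] [Algebra ℂ B]

/-- The substitution `g ↦ g(u₁, …, uₙ, X + c)`. -/
def fiber (u : Fin n → A) (c : ℂ) : MvPolynomial (Fin (n + 1)) ℂ →ₐ[ℂ] Polynomial A :=
  aeval (Fin.snoc (α := fun _ => Polynomial A) (fun j => Polynomial.C (u j))
    (Polynomial.X + Polynomial.C (algebraMap ℂ A c)))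

@[simp]
theorem fiber_X_castSucc (u : Fin n → A) (c : ℂ) (j : Fin n) :
    fiber u c (X j.castSucc) = Polynomial.C (u j) := by
  simp [fiber]

@[simp]
theorem fiber_X_last (u : Fin n → A) (c : ℂ) :
    fiber u c (X (Fin.last n)) = Polynomial.X + Polynomial.C (algebraMap ℂ A c) := by
  simp [fiber]

theorem fiber_rename_castSucc (u : Fin n → A) (c : ℂ) (p : MvPolynomial (Fin n) ℂ) :
    fiber u c (rename Fin.castSucc p) = Polynomial.C (aeval u p) := by
  have : (fiber u c).comp (rename Fin.castSucc) = Polynomial.CAlgHom.comp (aeval u) :=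
    MvPolynomial.algHom_ext fun i => by simp
  exact DFunLike.congr_fun this p

theorem fiber_map (u : Fin n → A) (c : ℂ) (ε : A →ₐ[ℂ] B) (p : MvPolynomial (Fin (n + 1)) ℂ) :
    (fiber u c p).map (ε : A →+* B) = fiber (fun j => ε (u j)) c p := by
  have : (Polynomial.mapAlgHom ε).comp (fiber u c) = fiber (fun j => ε (u j)) c :=
    MvPolynomial.algHom_ext fun i => by
      induction i using Fin.lastCases <;> simp
  exact DFunLike.congr_fun this p

theorem fiber_coeff_zero (b : Fin n → ℂ) (c : ℂ) (p : MvPolynomial (Fin (n + 1)) ℂ) :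
    (fiber b c p).coeff 0 = eval (Fin.snoc (α := fun _ => ℂ) b c) p := by
  have : (Polynomial.aeval (0 : ℂ)).comp (fiber b c) = aeval (Fin.snoc (α := fun _ => ℂ) b c) :=
    MvPolynomial.algHom_ext fun i => by
      induction i using Fin.lastCases <;> simp
  have h := DFunLike.congr_fun this p
  rw [aeval_eq_eval] at h
  rw [← h, Polynomial.coeff_zero_eq_aeval_zero]
  rfl

end Fiber

/-- The equation `G = 0` expresses the top power of the root through coefficients in `I`, so this
power lies in the nilpotent extension of `I`. -/
theorem isNilpotent_root {A : Type*} [CommRing A] {I : Ideal A} (hI : IsNilpotent I)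
    {G : Polynomial A} (hG : G.Monic) (hlt : ∀ i < G.natDegree, G.coeff i ∈ I) :
    IsNilpotent (AdjoinRoot.root G) := by
  obtain ⟨N, hN⟩ := hI
  have hmem : AdjoinRoot.root G ^ G.natDegree ∈ I.map (AdjoinRoot.of G) := by
    have h0 : AdjoinRoot.mk G G = 0 := AdjoinRoot.mk_self
    conv at h0 => lhs; arg 2; rw [hG.as_sum]
    simp only [map_add, map_pow, map_sum, map_mul, AdjoinRoot.mk_X, AdjoinRoot.mk_C] at h0
    rw [eq_neg_of_add_eq_zero_left h0]
    exact neg_mem (sum_mem fun i hi => Ideal.mul_mem_right _ _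
      (Ideal.mem_map_of_mem _ (hlt i (Finset.mem_range.1 hi))))
  refine ⟨G.natDegree * N, ?_⟩
  have := Ideal.pow_mem_pow hmem N
  rwa [← Ideal.map_pow, hN, Ideal.zero_eq_bot, Ideal.map_bot, Ideal.mem_bot, ← pow_mul] at this

/-- Multiplicities multiply: the multiplicity of `(b, c)` is that of `b` in the first `n`
equations times the order at `c` of the last equation specialized at `b`. -/
theorem multiplicityAt_snoc {n : ℕ} {F : PolySystem (n + 1)} {F' : PolySystem n}
    (hF : ∀ i : Fin n, F i.castSucc = rename Fin.castSucc (F' i)) {b : Fin n → ℂ} (c : ℂ)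
    (hb : b ∈ solutionSet F') (hfin : multiplicityAt b F' ≠ ⊤)
    (hp : fiber b c (F (Fin.last n)) ≠ 0) :
    multiplicityAt (Fin.snoc (α := fun _ => ℂ) b c) F =
      (fiber b c (F (Fin.last n))).natTrailingDegree * multiplicityAt b F' := by
  have := isLocalRing_solutionRing hb
  have hnil := isNilpotent_maximalIdeal hfin
  obtain ⟨ε, hε⟩ := exists_evaluation hb
  set A := SolutionRing F' b
  let u : Fin n → A := fun j => germ F' b (X j)
  have hu : ∀ p, aeval u p = germ F' b p := fun p =>
    DFunLike.congr_fun (MvPolynomial.algHom_ext (by simp [u]) : aeval u = germ F' b) p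
  have hεu : (fun j => ε (u j)) = b := funext fun j => by simp [u, hε]
  have hcoeff : ∀ p i, ε ((fiber u c p).coeff i) = (fiber b c p).coeff i := fun p i => by
    have h := fiber_map u c ε p
    rw [hεu] at h
    rw [← h, Polynomial.coeff_map]
    rfl
  set k := (fiber b c (F (Fin.last n))).natTrailingDegree
  obtain ⟨G, H, hG, hGk, hlt, hGH, hH⟩ := exists_monic_mul_eq hnil (fiber u c (F (Fin.last n))) k
    (by rw [mem_maximalIdeal_iff ε, hcoeff]
        exact Polynomial.trailingCoeff_nonzero_iff_nonzero.2 hp)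
    (fun i hi => by
      rw [mem_maximalIdeal_iff ε, hcoeff]
      exact Polynomial.coeff_eq_zero_of_lt_natTrailingDegree hi)
  have hroot : IsNilpotent (AdjoinRoot.root G) := isNilpotent_root hnil hG (by rwa [hGk])
  set a : Fin (n + 1) → ℂ := Fin.snoc (α := fun _ => ℂ) b c
  -- the map to the algebra generated by a root of `G`
  let mkG : Polynomial A →ₐ[ℂ] AdjoinRoot G := (AdjoinRoot.mkₐ G).restrictScalars ℂ
  have hmkG : ∀ q, mkG q = AdjoinRoot.mk G q := fun _ => rfl
  obtain ⟨Φ, hΦ⟩ := exists_lift (F := F) (a := a) (mkG.comp (fiber u c))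
    (fun p hpa => by
      -- The image is a multiple of the nilpotent root plus the constant term, which is a unit of
      -- `A` since `p` does not vanish at `a`.
      obtain ⟨q, hq⟩ := Polynomial.X_dvd_sub_C (p := fiber u c p)
      rw [sub_eq_iff_eq_add'] at hq
      rw [AlgHom.comp_apply, hq, hmkG, map_add, map_mul, AdjoinRoot.mk_X, AdjoinRoot.mk_C]
      refine IsNilpotent.isUnit_add_left_of_commute ?_ (IsUnit.map _ ?_) (Commute.all _ _)
      · exact (Commute.all _ _).isNilpotent_mul_right hroot
      · rwa [isUnit_iff_evaluation_ne_zero ε, hcoeff, fiber_coeff_zero])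
    (fun i => by
      induction i using Fin.lastCases with
      | last => simp [hGH, hmkG]
      | cast i => simp [hF, fiber_rename_castSucc, hu, germ_apply_eq_zero])
  -- the map back
  have ha' : ∀ p, eval a (rename Fin.castSucc p) = eval b p := fun p => by
    rw [eval_rename]; congr 2; funext j; simp [a]
  obtain ⟨ψ, hψ⟩ := exists_lift (F := F') (a := b) ((germ F a).comp (rename Fin.castSucc))
    (fun p hpb => isUnit_germ F a ((ha' p).trans_ne hpb))
    (fun i => by rw [AlgHom.comp_apply, ← hF, germ_apply_eq_zero])
  let x : SolutionRing F a := germ F a (X (Fin.last n) - C c)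
  let θ : Polynomial A →ₐ[ℂ] SolutionRing F a := Polynomial.eval₂AlgHom ψ x fun _ => Commute.all _ _
  have hθX : θ Polynomial.X = x := by simp [θ]
  have hθC : ∀ y, θ (Polynomial.C y) = ψ y := fun y => by simp [θ]
  have hθ : ∀ p, θ (fiber u c p) = germ F a p := fun p => by
    have : θ.comp (fiber u c) = germ F a := MvPolynomial.algHom_ext fun i => by
      induction i using Fin.lastCases with
      | last =>
        have : germ F a (C c) = algebraMap ℂ _ c := (germ F a).commutes c
        have h : ψ (algebraMap ℂ A c) = algebraMap ℂ _ c := ψ.commutes c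
        simp [hθX, hθC, x, this, h]
      | cast i => simp [hθC, u, hψ]
    exact DFunLike.congr_fun this p
  have hHu : IsUnit (θ H) := by
    -- At a solution, `x` evaluates to zero, so `H` has the same value there as its invertible
    -- constant term. Otherwise (the case `k = 0`) the local ring is zero.
    by_cases ha : a ∈ solutionSet F
    · have := isLocalRing_solutionRing ha
      obtain ⟨η, hη⟩ := exists_evaluation ha
      obtain ⟨q, hq⟩ := Polynomial.X_dvd_sub_C (p := H)
      rw [sub_eq_iff_eq_add'] at hq
      have hx : η x = 0 := by simp [x, hη, a]
      rw [isUnit_iff_evaluation_ne_zero η, hq, map_add, map_mul, map_add, map_mul, hθX, hx,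
        zero_mul, add_zero, hθC]
      exact ((hH.map ψ).map η).ne_zero
    · have : ∃ i, eval a (F i) ≠ 0 := by simpa [solutionSet] using ha
      obtain ⟨i, hi⟩ := this
      have h := isUnit_germ F a hi
      rw [germ_apply_eq_zero, isUnit_zero_iff] at h
      have := subsingleton_of_zero_eq_one h
      exact isUnit_of_subsingleton _
  have hθG : θ G = 0 := by
    have := hθ (F (Fin.last n))
    rw [hGH, map_mul, germ_apply_eq_zero] at this
    exact (hHu.mul_left_eq_zero).1 this
  let Ψ : AdjoinRoot G →ₐ[ℂ] SolutionRing F a := AdjoinRoot.liftAlgHom G ψ x hθG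
  have hΨ : ∀ q, Ψ (mkG q) = θ q := fun q => AdjoinRoot.liftAlgHom_mk ..
  let e : SolutionRing F a ≃ₐ[ℂ] AdjoinRoot G := AlgEquiv.ofAlgHom Φ Ψ
    (by
      have : Φ.comp θ = mkG := Polynomial.algHom_ext'
        (SolutionRing.algHom_ext fun i => by simp [hθC, hψ, hΦ, u])
        (by
          have h : AdjoinRoot.of G (algebraMap ℂ A c) = algebraMap ℂ _ c :=
            (IsScalarTower.algebraMap_apply ℂ A (AdjoinRoot G) c).symm
          simp [hθX, x, hΦ, hmkG, h])
      refine AlgHom.ext fun y => ?_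
      obtain ⟨q, rfl⟩ := AdjoinRoot.mk_surjective y
      rw [AlgHom.comp_apply, ← hmkG, hΨ]
      exact DFunLike.congr_fun this q)
    (SolutionRing.algHom_ext fun i => by simp [hΦ, hΨ, hθ])
  have hfree : Module.Free A (AdjoinRoot G) := .of_basis (AdjoinRoot.powerBasis' hG).basis
  have hrank : Module.rank A (AdjoinRoot G) = k := by
    rw [rank_eq_card_basis (AdjoinRoot.powerBasis' hG).basis]
    simp [hGk]
  rw [multiplicityAt_eq, multiplicityAt_eq, e.toLinearEquiv.rank_eq, ← rank_mul_rank ℂ A, hrank,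
    map_mul, Cardinal.toENat_nat, mul_comm]

/-! ### Sums of extended natural numbers -/

theorem summable_enat {ι : Type*} (f : ι → ℕ∞) : Summable f :=
  ⟨_, hasSum_of_isLUB _ (isLUB_iSup (f := fun s : Finset ι => ∑ i ∈ s, f i))⟩

theorem tsum_enat_eq_top {ι : Type*} [Infinite ι] {f : ι → ℕ∞} (hf : ∀ i, f i ≠ 0) :
    ∑' i, f i = ⊤ := by
  refine ENat.eq_top_iff_forall_ge.2 fun N => ?_
  obtain ⟨s, hs⟩ := Infinite.exists_subset_card_eq ι N
  calc (N : ℕ∞) = ∑ _i ∈ s, (1 : ℕ∞) := by simp [hs]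
    _ ≤ ∑ i ∈ s, f i := Finset.sum_le_sum fun i _ => Order.one_le_iff_ne_zero.2 (hf i)
    _ ≤ ∑' i, f i := (summable_enat f).sum_le_tsum s fun _ _ => zero_le

theorem multiplicityAt_ne_top {n : ℕ} {S : Set (Fin n → ℂ)} {F : PolySystem n}
    (h : totalMultiplicity S F ≠ ⊤) {a : Fin n → ℂ} (ha : a ∈ S ∩ solutionSet F) :
    multiplicityAt a F ≠ ⊤ :=
  ne_top_of_le_ne_top h <|
    (summable_enat fun a : ↥(S ∩ solutionSet F) => multiplicityAt (a : Fin n → ℂ) F).le_tsum'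
      ⟨a, ha⟩

/-! ### Specializations -/

theorem Disc.ball_subset (D : Disc) : Metric.ball D.center D.radius ⊆ D.toSet := by
  unfold Disc.toSet
  split
  · exact Metric.ball_subset_closedBall
  · exact subset_rfl

theorem Disc.toSet_infinite (D : Disc) : D.toSet.Infinite :=
  (infinite_of_mem_nhds D.center (Metric.ball_mem_nhds _ D.radius_pos)).mono D.ball_subset

/-- Every point of the infinite set `D` is a solution. This forces the specializations in a tower to
be nonzero. -/
theorem totalMultiplicity_eq_top (D : Disc) {F : PolySystem 1} (hF : F 0 = 0) :
    totalMultiplicity (Polydisc.toSet fun _ : Fin 1 => D) F = ⊤ := by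
  have hinf : (Polydisc.toSet (fun _ : Fin 1 => D) ∩ solutionSet F).Infinite := by
    refine (D.toSet_infinite.image (f := fun c => fun _ : Fin 1 => c)
      fun c _ d _ h => congrFun h 0).mono ?_
    rintro _ ⟨c, hc, rfl⟩
    exact ⟨fun _ => hc, fun i => by rw [Subsingleton.elim i 0, hF, map_zero]⟩
  have := hinf.to_subtype
  exact tsum_enat_eq_top fun a => multiplicityAt_ne_zero a.2.2

section Specialize

variable {n : ℕ} (g : MvPolynomial (Fin (n + 1)) ℂ) (b : Fin n → ℂ)

theorem fiber_specialize (u : Fin 0 → ℂ) (c : ℂ) :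
    fiber u c (specialize g b 0) = fiber b c g := by
  have : (fiber u c).comp (bind₁ (Fin.snoc (α := fun _ => MvPolynomial (Fin 1) ℂ)
      (fun j => C (b j)) (X 0))) = fiber b c := MvPolynomial.algHom_ext fun i => by
    induction i using Fin.lastCases with
    | last => simpa using fiber_X_last u c
    | cast i => simp [← MvPolynomial.algebraMap_eq]
  exact DFunLike.congr_fun this g

theorem specialize_eq_zero {c : ℂ} (h : fiber b c g = 0) : specialize g b 0 = 0 := by
  -- Substituting `X 0 - C c` undoes the shift by `c`.
  have : (Polynomial.aeval (X 0 - C c : MvPolynomial (Fin 1) ℂ)).comp (fiber b c) =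
      bind₁ (Fin.snoc (α := fun _ => MvPolynomial (Fin 1) ℂ) (fun j => C (b j)) (X 0)) :=
    MvPolynomial.algHom_ext fun i => by
      induction i using Fin.lastCases <;> simp [MvPolynomial.algebraMap_eq]
  have h' := DFunLike.congr_fun this g
  rw [AlgHom.comp_apply, h, map_zero] at h'
  exact h'.symm

theorem snoc_zero_eq (x : Fin 1 → ℂ) :
    Fin.snoc (α := fun _ => ℂ) (Fin.elim0 : Fin 0 → ℂ) (x 0) = x :=
  funext fun i => by
    rw [show i = Fin.last 0 from Subsingleton.elim (α := Fin 1) _ _, Fin.snoc_last]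
    rfl

theorem eval_specialize (x : Fin 1 → ℂ) :
    eval x (specialize g b 0) = eval (Fin.snoc (α := fun _ => ℂ) b (x 0)) g := by
  rw [← fiber_coeff_zero, ← fiber_specialize g b Fin.elim0, fiber_coeff_zero, snoc_zero_eq]

/-- The case of `multiplicityAt_snoc` over the empty system, whose only point has multiplicity one.
-/
theorem multiplicityAt_specialize (x : Fin 1 → ℂ) (h : fiber b (x 0) g ≠ 0) :
    multiplicityAt x (specialize g b) = (fiber b (x 0) g).natTrailingDegree := by
  have hone := multiplicityAt_of_isEmpty (fun i => i.elim0) Fin.elim0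
  have := multiplicityAt_snoc (F := specialize g b) (F' := fun i => i.elim0) (fun i => i.elim0)
    (b := Fin.elim0) (x 0) (fun i => i.elim0) (by rw [hone]; exact ENat.one_ne_top)
    (by rwa [Fin.last_zero, fiber_specialize])
  rwa [hone, mul_one, Fin.last_zero, fiber_specialize, snoc_zero_eq] at this

end Specialize

/-! ### Total multiplicities of towers -/

section Step

variable {n : ℕ} {F : PolySystem (n + 1)} {F' : PolySystem n}

theorem snoc_mem_iff (hF : ∀ i : Fin n, F i.castSucc = rename Fin.castSucc (F' i))
    (Δ : Polydisc (n + 1)) (b : Fin n → ℂ) (x : Fin 1 → ℂ) :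
    Fin.snoc (α := fun _ => ℂ) b (x 0) ∈ Δ.toSet ∩ solutionSet F ↔
      b ∈ Polydisc.toSet (Fin.init Δ) ∩ solutionSet F' ∧
        x ∈ Polydisc.toSet (fun _ : Fin 1 => Δ (Fin.last n)) ∩
          solutionSet (specialize (F (Fin.last n)) b) := by
  have h : ∀ p : MvPolynomial (Fin n) ℂ, eval (Fin.snoc (α := fun _ => ℂ) b (x 0))
      (rename Fin.castSucc p) = eval b p := fun p => by
    rw [eval_rename]; congr 2; funext j; simp
  simp only [Set.mem_inter_iff, Polydisc.toSet, solutionSet, Set.mem_ofPred_eq,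
    Fin.forall_fin_succ' (n := n), Fin.snoc_castSucc, Fin.snoc_last, hF, h, Fin.forall_fin_one,
    eval_specialize, Fin.init]
  tauto

theorem totalMultiplicity_succ (hF : ∀ i : Fin n, F i.castSucc = rename Fin.castSucc (F' i))
    (Δ : Polydisc (n + 1)) (m : ℕ)
    (hfin : totalMultiplicity (Polydisc.toSet (Fin.init Δ)) F' ≠ ⊤)
    (hm : ∀ b ∈ Polydisc.toSet (Fin.init Δ : Polydisc n), (m : ℕ∞) = totalMultiplicity
      (Polydisc.toSet fun _ : Fin 1 => Δ (Fin.last n)) (specialize (F (Fin.last n)) b)) :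
    totalMultiplicity Δ.toSet F =
      m * totalMultiplicity (Polydisc.toSet (Fin.init Δ)) F' := by
  -- Solutions are grouped by their projection `b`; sums in `ℕ∞` may be regrouped freely.
  let φ : (Σ b : ↥(Polydisc.toSet (Fin.init Δ) ∩ solutionSet F'),
      ↥(Polydisc.toSet (fun _ : Fin 1 => Δ (Fin.last n)) ∩
        solutionSet (specialize (F (Fin.last n)) b))) → ↥(Δ.toSet ∩ solutionSet F) :=
    fun p => ⟨Fin.snoc (α := fun _ => ℂ) p.1.1 (p.2.1 0),
      (snoc_mem_iff hF Δ _ _).2 ⟨p.1.2, p.2.2⟩⟩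
  have hφ : Function.Bijective φ := by
    constructor
    · rintro ⟨⟨b, hb⟩, x, hx⟩ ⟨⟨b', hb'⟩, x', hx'⟩ h
      have h' := congrFun (Subtype.ext_iff.1 h)
      obtain rfl : b = b' := funext fun i => by simpa [φ] using h' i.castSucc
      have h2 : x 0 = x' 0 := by simpa [φ] using h' (Fin.last n)
      obtain rfl : x = x' := funext fun i => by rw [Subsingleton.elim i 0, h2]
      rfl
    · rintro ⟨z, hz⟩
      have hsnoc : Fin.snoc (α := fun _ => ℂ) (Fin.init z) (z (Fin.last n)) = z :=
        Fin.snoc_init_self z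
      obtain ⟨h1, h2⟩ := (snoc_mem_iff hF Δ (Fin.init z) fun _ => z (Fin.last n)).1
        (by rwa [hsnoc])
      exact ⟨⟨⟨_, h1⟩, ⟨_, h2⟩⟩, Subtype.ext hsnoc⟩
  rw [totalMultiplicity, totalMultiplicity, ← (Equiv.ofBijective φ hφ).tsum_eq,
    (summable_enat _).tsum_sigma' fun _ => summable_enat _,
    ← (summable_enat _).tsum_mul_left]
  refine tsum_congr fun b => ?_
  rw [hm b b.2.1, totalMultiplicity, ← (summable_enat _).tsum_mul_right]
  refine tsum_congr fun x => ?_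
  have hne : fiber (b : Fin n → ℂ) ((x : Fin 1 → ℂ) 0) (F (Fin.last n)) ≠ 0 := fun h0 =>
    ENat.natCast_ne_top m <| (hm b b.2.1).trans <|
      totalMultiplicity_eq_top _ (specialize_eq_zero _ _ h0)
  rw [multiplicityAt_specialize _ _ _ hne]
  exact multiplicityAt_snoc hF _ b.2.2 (multiplicityAt_ne_top hfin b.2) hne

end Step

namespace TriangularSystem

variable {n : ℕ} (f : TriangularSystem (n + 1))

theorem toPolySystem_castSucc (i : Fin n) :
    f.toPolySystem i.castSucc = rename Fin.castSucc (f.init.toPolySystem i) := by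
  rw [toPolySystem, toPolySystem, rename_rename]
  rfl

theorem toPolySystem_last : f.toPolySystem (Fin.last n) = f.last :=
  rename_id_apply _

end TriangularSystem

theorem IsTower.totalMultiplicity_eq_prod : {n : ℕ} → {f : TriangularSystem (n + 1)} →
    {Δ : Polydisc (n + 1)} → {m : Fin (n + 1) → ℕ+} → IsTower f Δ m →
    totalMultiplicity Δ.toSet f.toPolySystem = ((∏ i, (m i : ℕ) : ℕ) : ℕ∞)
  | 0, f, Δ, m, h => by
    rw [Fin.prod_univ_one]
    exact Eq.symm h
  | n + 1, f, Δ, m, h => by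
    have ih := h.1.totalMultiplicity_eq_prod
    rw [totalMultiplicity_succ f.toPolySystem_castSucc Δ (m (Fin.last (n + 1)))
      -- The product formula in lower height supplies the finiteness.
      (by rw [ih]; exact ENat.natCast_ne_top _)
      (by rw [f.toPolySystem_last]; exact h.2), ih, Fin.prod_univ_castSucc (n := n + 1), mul_comm, Nat.cast_mul]
    rfl

theorem IsTower.totalMultiplicity_succ {n : ℕ} {f : TriangularSystem (n + 2)}
    {Δ : Polydisc (n + 2)} {m : Fin (n + 2) → ℕ+} (h : IsTower f Δ m) :
    totalMultiplicity Δ.toSet f.toPolySystem = ((m (Fin.last (n + 1)) : ℕ) : ℕ∞) *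
      totalMultiplicity (Polydisc.toSet (Fin.init Δ)) f.init.toPolySystem :=
  ClusterTower.totalMultiplicity_succ f.toPolySystem_castSucc Δ _
    (by rw [h.1.totalMultiplicity_eq_prod]; exact ENat.natCast_ne_top _)
    (by rw [f.toPolySystem_last]; exact h.2)

end ClusterTower

end

/-- The first part concerns towers of height greater than one, the second part towers of any
height.  A natural tower is in particular a tower. -/
theorem mainTheorem2 (n : ℕ) (f : ClusterTower.TriangularSystem (n + 1))
    (Δ : ClusterTower.Polydisc (n + 1)) (m : Fin (n + 1) → ℕ+)
    (h : ClusterTower.IsTower f Δ m) :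
    (1 < n + 1 →
      ClusterTower.totalMultiplicity Δ.toSet f.toPolySystem =
        ((m (Fin.last n) : ℕ) : ℕ∞) *
          ClusterTower.totalMultiplicity
            (ClusterTower.Polydisc.toSet (Fin.init Δ)) f.init.toPolySystem) ∧
    ClusterTower.totalMultiplicity Δ.toSet f.toPolySystem =
      ((∏ i, (m i : ℕ) : ℕ) : ℕ∞) := by
  refine ⟨fun hn => ?_, h.totalMultiplicity_eq_prod⟩
  obtain _ | n := n
  · exact absurd hn (lt_irrefl 1)
  · exact h.totalMultiplicity_succ
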